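/- Let $\overline a=(a_{22},a_{21},a_{20},a_{11},a_{10},a_{00})$ be indeterminates, put $a_{ij}=a_{ji}$, and let $$\Phi_{\overline a}(x,y)=\sum_{i,j=0}^{2}a_{ij}x^iy^j$$ be the general symmetric polynomial of partial degree $2$ over $\mathbb C$. For $n\ge 3$ let $C_n$ be the cycle with vertex set $\{1,\dots,n\}$ and edges $\{i,i+1\}$ $(1\le i<n)$ and $\{n,1\}$. In the affine space $\mathbb C^{6+n}$ with coordinates $(\overline a,x_1,\dots,x_n)$ put $$W(C_n)=\{\Phi_{\overline a}(x_i,x_j)=0 \text{ for every edge } ij \text{ of } C_n\},\qquad Z(C_n)=W(C_n)\cap\bigcup_{i>j}\{x_i=x_j\},$$ let $U(C_n)$ be the Zariski closure of $W(C_n)\setminus Z(C_n)$, let $\mathcal I(C_n)\subseteq\mathbb C[\overline a,x_1,\dots,x_n]$ be the ideal of all polynomials vanishing on $U(C_n)$, and let $\mathcal I_{\overline a}(C_n)=\mathcal I(C_n)\cap\mathbb C[\overline a]$ (the characteristic ideal of $C_n$) and $\mathcal I_{\overline a,x_1}(C_n)=\mathcal I(C_n)\cap\mathbb C[\overline a,x_1]$.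 Then the characteristic ideals of $C_3$, $C_4$, $C_5$ are the principal ideals $$\mathcal I_{\overline a}(C_3)=\langle\Delta_3\rangle,\qquad \mathcal I_{\overline a}(C_4)=\langle\Delta_4\rangle,\qquad \mathcal I_{\overline a}(C_5)=\langle\Delta_5\rangle$$ of $\mathbb C[\overline a]$, where $$\Delta_3=a_{22}a_{00}+a_{11}a_{20}-a_{20}^2-a_{21}a_{10},$$ $$\Delta_4=a_{22}a_{11}a_{00}-a_{22}a_{10}^2-a_{11}a_{20}^2+2a_{21}a_{20}a_{10}-a_{21}^2a_{00},$$ $$\begin{aligned} \Delta_5={}&a_{22}^3a_{00}^3-a_{21}^3a_{10}^3-4a_{22}a_{20}^3a_{10}^2+5a_{21}a_{20}^4a_{10}+a_{20}^2a_{10}^2a_{21}^2\\ &+a_{10}^2a_{21}^2a_{20}a_{11}-4a_{10}a_{21}a_{20}^3a_{11}-a_{22}^2a_{10}^4-a_{11}a_{20}^5-a_{20}^6\\ &+3a_{22}a_{11}a_{10}^2a_{20}^2+a_{22}a_{21}a_{11}a_{10}^3-a_{22}a_{11}^2a_{20}a_{10}^2+a_{11}^2a_{20}^4\\ &+4a_{22}^2a_{20}a_{10}^2a_{00}+3a_{11}a_{21}^2a_{20}^2a_{00}-2a_{22}a_{21}a_{20}^2a_{10}a_{00}\\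 &-a_{20}a_{11}^2a_{21}^2a_{00}-4a_{20}^3a_{21}^2a_{00}-3a_{22}^2a_{20}^2a_{00}^2+a_{22}^2a_{10}^2a_{11}a_{00}\\ &+a_{11}a_{21}^2a_{22}a_{00}^2-3a_{22}^2a_{10}a_{21}a_{00}^2+a_{10}a_{11}a_{21}^3a_{00}-a_{22}a_{20}^2a_{11}^2a_{00}\\ &-4a_{22}a_{10}a_{11}a_{20}a_{21}a_{00}+a_{22}a_{20}a_{11}^3a_{00}+2a_{22}a_{11}a_{20}^3a_{00}\\ &+4a_{22}a_{21}^2a_{20}a_{00}^2-a_{11}a_{22}^2a_{20}a_{00}^2+a_{22}a_{10}^2a_{21}^2a_{00}\\ &-a_{22}a_{10}a_{21}a_{11}^2a_{00}-a_{21}^4a_{00}^2+3a_{22}a_{20}^4a_{00}. \end{aligned}$$ Moreover, for $n=3$ and $n=4$, $\mathcal I_{\overline a,x_1}(C_n)=\mathcal I_{\overline a}(C_n)$ in the sense that $\mathcal I_{\overline a,x_1}(C_n)$ is the ideal of $\mathbb C[\overline a,x_1]$ generated by $\mathcal I_{\overline a}(C_n)$. -/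

import Mathlib

namespace PolyGraph

open MvPolynomial

/-- Names of the coefficients `a_{kl} = a_{lk}`, `0 ≤ k, l ≤ d`: unordered pairs of indices. -/
abbrev Coef (d : ℕ) : Type := Sym2 (Fin (d + 1))

/-- The polynomial ring `ℂ[a]` in the coefficients. -/
abbrev RingA (d : ℕ) : Type := MvPolynomial (Coef d) ℂ

/-- The polynomial ring `ℂ[a, x₁]` in the coefficients and one vertex variable. -/
abbrev RingAX (d : ℕ) : Type := MvPolynomial (Coef d ⊕ Unit) ℂ

/-- The polynomial ring `ℂ[a, x₁, …, xₙ]`. -/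
abbrev RingFull (d n : ℕ) : Type := MvPolynomial (Coef d ⊕ Fin n) ℂ

/-- The affine space of points `(a, x₁, …, xₙ)`. -/
abbrev Pt (d n : ℕ) : Type := Coef d ⊕ Fin n → ℂ

section

variable (d : ℕ) {n : ℕ}

/-- `Φ_a(x_i, x_j) = ∑_{k,l=0}^d a_{kl} x_i^k x_j^l`, with `a_{kl} = a_{lk}`. -/
noncomputable def Phi (i j : Fin n) : RingFull d n :=
  ∑ k : Fin (d + 1), ∑ l : Fin (d + 1),
    X (Sum.inl s(k, l)) * X (Sum.inr i) ^ (k : ℕ) * X (Sum.inr j) ^ (l : ℕ)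

variable (H : SimpleGraph (Fin n))

/-- The system `S(H)` of the polynomials `Φ_a(x_i, x_j)`, `ij` an edge of `H`. -/
def system : Set (RingFull d n) :=
  {p | ∃ i j : Fin n, H.Adj i j ∧ p = Phi d i j}

/-- The variety `W(H)` of common zeros of `S(H)`. -/
def varietyW : Set (Pt d n) :=
  {P | ∀ p ∈ system d H, aeval P p = 0}

/-- `Z(H) = W(H) ∩ ⋃_{i>j} V(x_i - x_j)`. -/
def varietyZ : Set (Pt d n) :=
  varietyW d H ∩ {P | ∃ i j : Fin n, j < i ∧ P (Sum.inr i) = P (Sum.inr j)}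

/-- `U(H)`, the Zariski closure of `W(H) \ Z(H)`. -/
noncomputable def varietyU : Set (Pt d n) :=
  zeroLocus ℂ (vanishingIdeal ℂ (varietyW d H \ varietyZ d H))

/-- The ideal `I(H)` of all polynomials in `ℂ[a, x₁, …, xₙ]` vanishing on `U(H)`. -/
noncomputable def idealI : Ideal (RingFull d n) :=
  vanishingIdeal ℂ (varietyU d H)

/-- The characteristic ideal `I_a(H) = I(H) ∩ ℂ[a]`. -/
noncomputable def charIdeal : Ideal (RingA d) :=
  (idealI d H).comap
    (rename (Sum.inl : Coef d → Coef d ⊕ Fin n) : RingA d →ₐ[ℂ] RingFull d n)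

/-- The ideal `I_{a,x_v}(H) = I(H) ∩ ℂ[a, x_v]`. -/
noncomputable def charIdealAt (v : Fin n) : Ideal (RingAX d) :=
  (idealI d H).comap
    (rename (Sum.map id (fun _ : Unit => v) : Coef d ⊕ Unit → Coef d ⊕ Fin n) :
      RingAX d →ₐ[ℂ] RingFull d n)

/-- The inclusion `ℂ[a] ⊆ ℂ[a, x₁]`. -/
noncomputable def inclA : RingA d →ₐ[ℂ] RingAX d :=
  rename Sum.inl

end

/-- The coefficient variable `a_{ij}`, for partial degree two. -/
noncomputable def a (i j : Fin 3) : RingA 2 := X s(i, j)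

noncomputable def Delta3 : RingA 2 :=
  a 2 2 * a 0 0 + a 1 1 * a 2 0 - a 2 0 ^ 2 - a 2 1 * a 1 0

noncomputable def Delta4 : RingA 2 :=
  a 2 2 * a 1 1 * a 0 0 - a 2 2 * a 1 0 ^ 2 - a 1 1 * a 2 0 ^ 2
    + 2 * a 2 1 * a 2 0 * a 1 0 - a 2 1 ^ 2 * a 0 0

noncomputable def Delta5 : RingA 2 :=
  a 2 2 ^ 3 * a 0 0 ^ 3 - a 2 1 ^ 3 * a 1 0 ^ 3 - 4 * a 2 2 * a 2 0 ^ 3 * a 1 0 ^ 2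
    + 5 * a 2 1 * a 2 0 ^ 4 * a 1 0 + a 2 0 ^ 2 * a 1 0 ^ 2 * a 2 1 ^ 2
    + a 1 0 ^ 2 * a 2 1 ^ 2 * a 2 0 * a 1 1 - 4 * a 1 0 * a 2 1 * a 2 0 ^ 3 * a 1 1
    - a 2 2 ^ 2 * a 1 0 ^ 4 - a 1 1 * a 2 0 ^ 5 - a 2 0 ^ 6
    + 3 * a 2 2 * a 1 1 * a 1 0 ^ 2 * a 2 0 ^ 2 + a 2 2 * a 2 1 * a 1 1 * a 1 0 ^ 3
    - a 2 2 * a 1 1 ^ 2 * a 2 0 * a 1 0 ^ 2 + a 1 1 ^ 2 * a 2 0 ^ 4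
    + 4 * a 2 2 ^ 2 * a 2 0 * a 1 0 ^ 2 * a 0 0 + 3 * a 1 1 * a 2 1 ^ 2 * a 2 0 ^ 2 * a 0 0
    - 2 * a 2 2 * a 2 1 * a 2 0 ^ 2 * a 1 0 * a 0 0
    - a 2 0 * a 1 1 ^ 2 * a 2 1 ^ 2 * a 0 0 - 4 * a 2 0 ^ 3 * a 2 1 ^ 2 * a 0 0
    - 3 * a 2 2 ^ 2 * a 2 0 ^ 2 * a 0 0 ^ 2 + a 2 2 ^ 2 * a 1 0 ^ 2 * a 1 1 * a 0 0
    + a 1 1 * a 2 1 ^ 2 * a 2 2 * a 0 0 ^ 2 - 3 * a 2 2 ^ 2 * a 1 0 * a 2 1 * a 0 0 ^ 2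
    + a 1 0 * a 1 1 * a 2 1 ^ 3 * a 0 0 - a 2 2 * a 2 0 ^ 2 * a 1 1 ^ 2 * a 0 0
    - 4 * a 2 2 * a 1 0 * a 1 1 * a 2 0 * a 2 1 * a 0 0
    + a 2 2 * a 2 0 * a 1 1 ^ 3 * a 0 0 + 2 * a 2 2 * a 1 1 * a 2 0 ^ 3 * a 0 0
    + 4 * a 2 2 * a 2 1 ^ 2 * a 2 0 * a 0 0 ^ 2 - a 1 1 * a 2 2 ^ 2 * a 2 0 * a 0 0 ^ 2
    + a 2 2 * a 1 0 ^ 2 * a 2 1 ^ 2 * a 0 0 - a 2 2 * a 1 0 * a 2 1 * a 1 1 ^ 2 * a 0 0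
    - a 2 1 ^ 4 * a 0 0 ^ 2 + 3 * a 2 2 * a 2 0 ^ 4 * a 0 0

end PolyGraph

/-! Write A, B, C, D, E, F for a₂₂, a₂₁, a₂₀, a₁₁, a₁₀, a₀₀, and Φ(x, y) = p(x)y² + q(x)y + r(x)
with p = Ax² + Bx + C, q = Bx² + Dx + E, r = Cx² + Ex + F. The theorem is a Poncelet-type closure
statement: a vertex has only two neighbours, the roots of Φ(x, ·), and the cycle closes exactly when
one invariant of Φ vanishes, generically independently of the starting vertex. Necessity
(`delta3_eq_zero_of_triangle`, `delta4_eq_zero_of_cycle`, `delta5_eq_zero_of_cycle`) comes from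
Vieta's relations at the vertices. Conversely, on Δ = 0 and off the zero set of an explicit
polynomial, a cycle with distinct vertices is constructed (`exists_triangle`, `exists_four_cycle`,
`exists_five_cycle`); for n = 3, 4 it passes through an arbitrary generic x₁. Since Δ is
irreducible, the Nullstellensatz (`dvd_of_vanishes_generically`) shows that Δ divides every
polynomial vanishing at such generic points. For n = 3, 4 this is applied in ℂ[a, x₁] and then
restricted to ℂ[a]; for n = 5 it is applied in ℂ[a], with the pentagon based at 0. -/

namespace PolyGraph

/-! ### Invariants of the biquadratic form and polynomial identities between them -/

section Scalars

variable {R : Type*} [CommRing R]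

/-- The general symmetric biquadratic polynomial. -/
def biquad (A B C D E F x y : R) : R :=
  A * x ^ 2 * y ^ 2 + B * (x ^ 2 * y + x * y ^ 2) + C * (x ^ 2 + y ^ 2) + D * x * y
    + E * (x + y) + F

def delta3 (A B C D E F : R) : R :=
  A * F + D * C - C ^ 2 - B * E

def delta4 (A B C D E F : R) : R :=
  A * D * F - A * E ^ 2 - D * C ^ 2 + 2 * B * C * E - B ^ 2 * F

def delta5 (A B C D E F : R) : R :=
  A ^ 3 * F ^ 3 - B ^ 3 * E ^ 3 - 4 * A * C ^ 3 * E ^ 2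
    + 5 * B * C ^ 4 * E + C ^ 2 * E ^ 2 * B ^ 2
    + E ^ 2 * B ^ 2 * C * D - 4 * E * B * C ^ 3 * D
    - A ^ 2 * E ^ 4 - D * C ^ 5 - C ^ 6
    + 3 * A * D * E ^ 2 * C ^ 2 + A * B * D * E ^ 3
    - A * D ^ 2 * C * E ^ 2 + D ^ 2 * C ^ 4
    + 4 * A ^ 2 * C * E ^ 2 * F + 3 * D * B ^ 2 * C ^ 2 * F
    - 2 * A * B * C ^ 2 * E * F
    - C * D ^ 2 * B ^ 2 * F - 4 * C ^ 3 * B ^ 2 * F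
    - 3 * A ^ 2 * C ^ 2 * F ^ 2 + A ^ 2 * E ^ 2 * D * F
    + D * B ^ 2 * A * F ^ 2 - 3 * A ^ 2 * E * B * F ^ 2
    + E * D * B ^ 3 * F - A * C ^ 2 * D ^ 2 * F
    - 4 * A * E * D * C * B * F
    + A * C * D ^ 3 * F + 2 * A * D * C ^ 3 * F
    + 4 * A * B ^ 2 * C * F ^ 2 - D * A ^ 2 * C * F ^ 2
    + A * E ^ 2 * B ^ 2 * F - A * E * B * D ^ 2 * F
    - B ^ 4 * F ^ 2 + 3 * A * C ^ 4 * F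

/-- The resultant of `A y² + B y + C` and `C y² + E y + F`. -/
def resP (A B C E F : R) : R :=
  (C ^ 2 - A * F) ^ 2 - B * E * C ^ 2 - A * B * E * F + A * E ^ 2 * C + B ^ 2 * C * F

/-- The resultant of `B y² + D y + E` and `C y² + E y + F`. -/
def resQ (B C D E F : R) : R :=
  C ^ 2 * E ^ 2 - 2 * B * C * E * F + B ^ 2 * F ^ 2 - C * D * E ^ 2 - B * D * E * F
    + B * E ^ 3 + C * D ^ 2 * F

/-- The polarisation between `resP` and `resQ`. -/
def resS (A B C D E F : R) : R :=
  2 * C ^ 3 * E - 2 * B * C ^ 2 * F - 2 * A * C * E * F + 2 * A * B * F ^ 2 - B ^ 2 * E * F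
    + A * E ^ 3 - C ^ 2 * D * E - A * D * E * F + 2 * B * C * D * F

theorem biquad_comm (A B C D E F x y : R) :
    biquad A B C D E F x y = biquad A B C D E F y x := by
  unfold biquad; ring

/-- The arguments on the left are the coefficients of Φ(x + t, y + t). Translation invariance allows
a vertex of the pentagon to be moved to 0. -/
theorem delta5_translate (A B C D E F t : R) :
    delta5 A (B + 2 * A * t) (C + B * t + A * t ^ 2) (D + 4 * B * t + 4 * A * t ^ 2)
      (E + (2 * C + D) * t + 3 * B * t ^ 2 + 2 * A * t ^ 3)
      (F + 2 * E * t + (2 * C + D) * t ^ 2 + 2 * B * t ^ 3 + A * t ^ 4)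
    = delta5 A B C D E F := by
  unfold delta5; ring

theorem biquad_translate (A B C D E F t x y : R) :
    biquad A (B + 2 * A * t) (C + B * t + A * t ^ 2) (D + 4 * B * t + 4 * A * t ^ 2)
      (E + (2 * C + D) * t + 3 * B * t ^ 2 + 2 * A * t ^ 3)
      (F + 2 * E * t + (2 * C + D) * t ^ 2 + 2 * B * t ^ 3 + A * t ^ 4) (x - t) (y - t)
    = biquad A B C D E F x y := by
  unfold biquad; ring

/-- The left side is P²Φ(u, v) for uv = Q/P and u + v = -S/P, where P, Q, S are `resP`, `resQ`,
`resS`. These are the symmetric functions of the second neighbours u, v of the vertex 0. -/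
theorem delta5_mul_delta3_eq (A B C D E F : R) :
    A * resQ B C D E F ^ 2 - B * resQ B C D E F * resS A B C D E F
      + C * (resS A B C D E F ^ 2 - 2 * resQ B C D E F * resP A B C E F)
      + D * resQ B C D E F * resP A B C E F - E * resS A B C D E F * resP A B C E F
      + F * resP A B C E F ^ 2
    = delta5 A B C D E F * delta3 A B C D E F * F := by
  unfold delta5 delta3 resP resQ resS; ring

end Scalars
-- Necessity: a cycle with distinct vertices forces the invariant to vanish
section Closure

variable {K : Type*} [Field K]

theorem quadratic_root_resultant {α β C E F y : K} (h : α * y + β = 0)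
    (hy : C * y ^ 2 + E * y + F = 0) : C * β ^ 2 - E * α * β + F * α ^ 2 = 0 := by
  linear_combination α ^ 2 * hy + (C * (β - α * y) - E * α) * h

/-- Vieta's relations are kept free of division, so they survive p = 0; two distinct roots then
force q = r = 0. -/
theorem vieta_sum {p q r y z : K} (hyz : y ≠ z) (hy : p * y ^ 2 + q * y + r = 0)
    (hz : p * z ^ 2 + q * z + r = 0) : p * (y + z) + q = 0 := by
  apply mul_left_cancel₀ (sub_ne_zero.mpr hyz)
  linear_combination hy - hz

theorem vieta_prod {p q r y z : K} (hyz : y ≠ z) (hy : p * y ^ 2 + q * y + r = 0)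
    (hz : p * z ^ 2 + q * z + r = 0) : p * (y * z) - r = 0 := by
  linear_combination y * vieta_sum hyz hy hz - hy

theorem biquad_left (A B C D E F x y : K) :
    biquad A B C D E F x y = (A * x ^ 2 + B * x + C) * y ^ 2 + (B * x ^ 2 + D * x + E) * y
      + (C * x ^ 2 + E * x + F) := by
  unfold biquad; ring

theorem delta3_eq_zero_of_triangle {A B C D E F x y z : K} (hxy : x ≠ y) (hyz : y ≠ z)
    (hxz : x ≠ z) (h1 : biquad A B C D E F x y = 0) (h2 : biquad A B C D E F y z = 0)
    (h3 : biquad A B C D E F x z = 0) : delta3 A B C D E F = 0 := by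
  have h1' := biquad_comm A B C D E F x y ▸ h1
  have h2' := biquad_comm A B C D E F y z ▸ h2
  rw [biquad_left] at h1 h2 h3 h1' h2'
  have s1 := vieta_sum hyz h1 h3
  have s2 := vieta_sum hxz h1' h2
  -- The relations `c1`, `c0`, `c` are linear in the elementary symmetric functions of x, y, z;
  -- eliminating these leaves Δ₃.
  have c1 : B * (x + y + z) - C + D + A * (x * y + y * z + x * z) = 0 := by
    apply mul_left_cancel₀ (sub_ne_zero.mpr hxy)
    linear_combination s1 - s2
  have c0 : C * (x + y + z) + E - A * (x * y * z) = 0 := by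
    linear_combination s1 - x * c1
  have t1 := vieta_prod hyz h1 h3
  have c : C * (x * y + y * z + x * z) + B * (x * y * z) - F = 0 := by
    linear_combination t1 + x * c0
  unfold delta3
  linear_combination (-A) * c + C * c1 - B * c0

/-- Δ₄ is the determinant of the symmetric matrix M of Φ in the basis x², x, 1. As a bilinear form M
vanishes on the plane spanned by the vectors (x², x, 1), (z², z, 1) times the plane of y, w; two
such planes in 3-space force M to be singular. -/
theorem delta4_eq_zero_of_cycle {A B C D E F x y z w : K} (hxz : x ≠ z) (hyw : y ≠ w)
    (h1 : biquad A B C D E F x y = 0) (h2 : biquad A B C D E F y z = 0)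
    (h3 : biquad A B C D E F z w = 0) (h4 : biquad A B C D E F x w = 0) :
    delta4 A B C D E F = 0 := by
  have h2' := biquad_comm A B C D E F y z ▸ h2
  rw [biquad_left] at h1 h2' h3 h4
  have s1 := vieta_sum hyw h1 h4
  have s2 := vieta_sum hyw h2' h3
  have t1 := vieta_prod hyw h1 h4
  have t2 := vieta_prod hyw h2' h3
  -- Vieta at x and at z, reordered by powers of x and z, gives quadratics with the distinct roots
  -- x, z, so Vieta applies again. With s, t the sums and m, n the products, the four relations are
  -- the values of M on the bases (s, 1, 0), (m, 0, -1) and (t, 1, 0), (n, 0, -1) of the two planes,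
  -- up to sign.
  have u1 := vieta_sum (p := A * (y + w) + B) (q := B * (y + w) + D) (r := C * (y + w) + E) hxz
    (by linear_combination s1) (by linear_combination s2)
  have v1 := vieta_prod (p := A * (y + w) + B) (q := B * (y + w) + D) (r := C * (y + w) + E) hxz
    (by linear_combination s1) (by linear_combination s2)
  have u2 := vieta_sum (p := A * (y * w) - C) (q := B * (y * w) - E) (r := C * (y * w) - F) hxz
    (by linear_combination t1) (by linear_combination t2)
  have v2 := vieta_prod (p := A * (y * w) - C) (q := B * (y * w) - E) (r := C * (y * w) - F) hxz
    (by linear_combination t1) (by linear_combination t2)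
  generalize y + w = s at *
  generalize y * w = m at *
  generalize x + z = t at *
  generalize x * z = n at *
  unfold delta4
  linear_combination
    (A * (A * m * n - C * n - C * m + F) - (A * m - C) * (A * n - C)) * u1
      + ((A * m - C) * (A * t + B) - A * (A * m * t - C * t + B * m - E)) * v1
      + (A * s + B) * (A * n - C) * u2 - (A * s + B) * (A * t + B) * v2

/-- This is the degenerate case Φ(x, ·) ≡ 0, where a vertex no longer limits its neighbours; C, E, F
are then determined by A, B, D, x. -/
theorem delta5_eq_zero_of_isolated {A B C D E F x : K} (hp : A * x ^ 2 + B * x + C = 0)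
    (hq : B * x ^ 2 + D * x + E = 0) (hr : C * x ^ 2 + E * x + F = 0) :
    delta5 A B C D E F = 0 := by
  obtain rfl : C = -(A * x ^ 2 + B * x) := by linear_combination hp
  obtain rfl : E = -(B * x ^ 2 + D * x) := by linear_combination hq
  obtain rfl : F = -(-(A * x ^ 2 + B * x) * x ^ 2 + -(B * x ^ 2 + D * x) * x) := by
    linear_combination hr
  unfold delta5; ring

/-- If `x₁ = 0` has neighbours `y`, `z`, and `u`, `v` are the further neighbours of `y`, `z`,
then `Φ(u, v)` is a multiple of the product of the invariants of the 5-cycle and the triangle. -/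
theorem biquad_second_neighbors {A B C D E F y z u v : K} (hC : C ≠ 0)
    (hs : C * (y + z) + E = 0) (hm : C * (y * z) - F = 0)
    (hu : ((B * C - A * E) * y + (C ^ 2 - A * F)) * u
      + ((C * D - B * E) * y + (C * E - B * F)) = 0)
    (hv : ((B * C - A * E) * z + (C ^ 2 - A * F)) * v
      + ((C * D - B * E) * z + (C * E - B * F)) = 0) :
    resP A B C E F ^ 2 * biquad A B C D E F u v
      = delta5 A B C D E F * delta3 A B C D E F * F := by
  -- The linear factors are C·p and C·q reduced modulo Cy² + Ey + F. Products over its two roots y,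
  -- z are therefore symmetric and are evaluated by `hs` and `hm`.
  have hP : ((B * C - A * E) * y + (C ^ 2 - A * F)) * ((B * C - A * E) * z + (C ^ 2 - A * F))
      = resP A B C E F := by
    apply mul_left_cancel₀ hC
    unfold resP
    linear_combination (B * C - A * E) ^ 2 * hm + (B * C - A * E) * (C ^ 2 - A * F) * hs
  have hQ : ((C * D - B * E) * y + (C * E - B * F)) * ((C * D - B * E) * z + (C * E - B * F))
      = resQ B C D E F := by
    apply mul_left_cancel₀ hC
    unfold resQ
    linear_combination (C * D - B * E) ^ 2 * hm + (C * D - B * E) * (C * E - B * F) * hs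
  have hS : ((C * D - B * E) * y + (C * E - B * F)) * ((B * C - A * E) * z + (C ^ 2 - A * F))
      + ((C * D - B * E) * z + (C * E - B * F)) * ((B * C - A * E) * y + (C ^ 2 - A * F))
      = resS A B C D E F := by
    apply mul_left_cancel₀ hC
    unfold resS
    linear_combination 2 * (B * C - A * E) * (C * D - B * E) * hm
      + ((C * D - B * E) * (C ^ 2 - A * F) + (B * C - A * E) * (C * E - B * F)) * hs
  rw [← delta5_mul_delta3_eq, ← hP, ← hQ, ← hS]
  generalize (B * C - A * E) * y + (C ^ 2 - A * F) = w2 at *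
  generalize (B * C - A * E) * z + (C ^ 2 - A * F) = w5 at *
  obtain hu' := eq_neg_of_add_eq_zero_right hu
  obtain hv' := eq_neg_of_add_eq_zero_right hv
  rw [hu', hv']
  unfold biquad
  ring

/-- This is the closing condition of a triangle with vertex 0; for pentagons it controls the
extraneous factor Δ₃. -/
theorem biquad_neighbors_of_zero {A B C D E F y z : K}
    (hs : C * (y + z) + E = 0) (hm : C * (y * z) - F = 0) :
    C ^ 2 * biquad A B C D E F y z = delta3 A B C D E F * F := by
  have hE : E = -(C * (y + z)) := by linear_combination hs
  have hF : F = C * (y * z) := by linear_combination -hm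
  subst hE hF
  unfold biquad delta3
  ring

theorem delta5_eq_zero_of_cycle_at_zero {A B C D E F y u v z : K}
    (hyz : y ≠ z) (hy : y ≠ 0) (hz : z ≠ 0) (hu : u ≠ 0) (hv : v ≠ 0) (hzu : z ≠ u)
    (h1 : biquad A B C D E F 0 y = 0) (h2 : biquad A B C D E F y u = 0)
    (h3 : biquad A B C D E F u v = 0) (h4 : biquad A B C D E F v z = 0)
    (h5 : biquad A B C D E F 0 z = 0) : delta5 A B C D E F = 0 := by
  have h1' := biquad_comm A B C D E F 0 y ▸ h1
  have h5' := biquad_comm A B C D E F 0 z ▸ h5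
  have h4' := biquad_comm A B C D E F v z ▸ h4
  rw [biquad_left] at h1 h5 h1' h5' h2 h4'
  have s0 := vieta_sum hyz h1 h5
  have m0 := vieta_prod hyz h1 h5
  have sy := vieta_sum hu h2 h1'
  have my := vieta_prod hu h2 h1'
  have sz := vieta_sum hv h4' h5'
  have mz := vieta_prod hv h4' h5'
  simp only [mul_zero, zero_pow two_ne_zero, zero_add, add_zero] at s0 m0 sy sz my mz
  -- The leading coefficient of Φ(0, ·), Φ(y, ·) or Φ(z, ·) may vanish; by Vieta the whole quadratic
  -- is then zero.
  by_cases hC : C = 0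
  · exact delta5_eq_zero_of_isolated (x := 0) (by simp [hC])
      (by linear_combination s0 - (y + z) * hC) (by linear_combination -m0 + (y * z) * hC)
  by_cases hpy : A * y ^ 2 + B * y + C = 0
  · exact delta5_eq_zero_of_isolated hpy (by linear_combination sy - u * hpy)
      (by linear_combination -my)
  by_cases hpz : A * z ^ 2 + B * z + C = 0
  · exact delta5_eq_zero_of_isolated hpz (by linear_combination sz - v * hpz)
      (by linear_combination -mz)
  have hF : F ≠ 0 := by
    rw [← sub_eq_zero.mp m0]
    exact mul_ne_zero hC (mul_ne_zero hy hz)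
  have key := biquad_second_neighbors (A := A) (B := B) (D := D) (u := u) (v := v) hC s0 m0
    (by linear_combination C * sy + (A * u + B) * my) (by linear_combination C * sz + (A * v + B) * mz)
  rw [h3, mul_zero, eq_comm, mul_eq_zero, mul_eq_zero] at key
  rcases key with (h | h) | h
  · exact h
  -- If Δ₃ = 0, then y and z are adjacent, so 0 and z are the roots of Φ(y, ·). But 0 and u are as
  -- well, whence z = u.
  · have hb := biquad_neighbors_of_zero (A := A) (B := B) (D := D) s0 m0
    rw [h, zero_mul, mul_eq_zero, or_iff_right (pow_ne_zero 2 hC), biquad_left] at hb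
    exfalso
    have := vieta_sum hz hb h1'
    apply hzu
    apply mul_left_cancel₀ hpy
    linear_combination this - sy
  · exact absurd h hF

theorem delta5_eq_zero_of_cycle {A B C D E F x y u v z : K}
    (hyz : y ≠ z) (hy : y ≠ x) (hz : z ≠ x) (hu : u ≠ x) (hv : v ≠ x) (hzu : z ≠ u)
    (h1 : biquad A B C D E F x y = 0) (h2 : biquad A B C D E F y u = 0)
    (h3 : biquad A B C D E F u v = 0) (h4 : biquad A B C D E F v z = 0)
    (h5 : biquad A B C D E F x z = 0) : delta5 A B C D E F = 0 := by
  rw [← delta5_translate A B C D E F x]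
  rw [← biquad_translate A B C D E F x] at h1 h2 h3 h4 h5
  rw [sub_self] at h1 h5
  exact delta5_eq_zero_of_cycle_at_zero (by simpa using hyz) (sub_ne_zero.mpr hy)
    (sub_ne_zero.mpr hz) (sub_ne_zero.mpr hu) (sub_ne_zero.mpr hv) (by simpa using hzu)
    h1 h2 h3 h4 h5

end Closure
-- Sufficiency: construction of cycles at generic points of Δ = 0
theorem exists_distinct_roots {p q r : ℂ} (hp : p ≠ 0) (hd : q ^ 2 - 4 * p * r ≠ 0) :
    ∃ y z : ℂ, y ≠ z ∧ p * (y + z) + q = 0 ∧ p * (y * z) - r = 0 := by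
  obtain ⟨s, hs⟩ := IsAlgClosed.exists_pow_nat_eq (q ^ 2 - 4 * p * r) zero_lt_two
  have hs0 : s ≠ 0 := by rintro rfl; apply hd; rw [← hs]; simp
  refine ⟨(-q + s) / (2 * p), (-q - s) / (2 * p), ?_, ?_, ?_⟩
  · intro h
    field_simp at h
    apply hs0
    linear_combination h / 2
  · field_simp
    ring
  · field_simp
    linear_combination -hs

theorem root_of_vieta {p q r y z : ℂ} (hs : p * (y + z) + q = 0) (hm : p * (y * z) - r = 0) :
    p * y ^ 2 + q * y + r = 0 := by
  linear_combination y * hs - hm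

/-- Nonvanishing of this polynomial makes the triangle through `x` nondegenerate. -/
def generic3 {R : Type*} [CommRing R] (A B C D E F x : R) : R :=
  (A * x ^ 2 + B * x + C) * biquad A B C D E F x x
    * ((B * x ^ 2 + D * x + E) ^ 2 - 4 * (A * x ^ 2 + B * x + C) * (C * x ^ 2 + E * x + F))

/-- For the two neighbours y, z of x, p(x)²Φ(y, z) = Φ(x, x)Δ₃, so the triangle closes by itself.
The factor Φ(x, x) of `generic3` keeps x away from y and z. -/
theorem exists_triangle {A B C D E F x : ℂ} (hΔ : delta3 A B C D E F = 0)
    (h : generic3 A B C D E F x ≠ 0) : ∃ y z, x ≠ y ∧ x ≠ z ∧ y ≠ z ∧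
      biquad A B C D E F x y = 0 ∧ biquad A B C D E F y z = 0 ∧ biquad A B C D E F x z = 0 := by
  obtain ⟨⟨hp, hx⟩, hd⟩ := by simpa only [generic3, mul_ne_zero_iff] using h
  obtain ⟨y, z, hyz, hs, hm⟩ := exists_distinct_roots hp hd
  have h1 : biquad A B C D E F x y = 0 := by
    rw [biquad_left]; exact root_of_vieta hs hm
  have h2 : biquad A B C D E F x z = 0 := by
    rw [biquad_left]; exact root_of_vieta (add_comm y z ▸ hs) (mul_comm y z ▸ hm)
  refine ⟨y, z, by rintro rfl; exact hx h1, by rintro rfl; exact hx h2, hyz, h1, ?_, h2⟩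
  apply mul_left_cancel₀ (pow_ne_zero 2 hp)
  have hs' := eq_neg_of_add_eq_zero_left hs
  have hm' := sub_eq_zero.mp hm
  have : (A * x ^ 2 + B * x + C) ^ 2 * biquad A B C D E F y z
      = A * ((A * x ^ 2 + B * x + C) * (y * z)) ^ 2
        + B * ((A * x ^ 2 + B * x + C) * (y * z)) * ((A * x ^ 2 + B * x + C) * (y + z))
        + C * (((A * x ^ 2 + B * x + C) * (y + z)) ^ 2
          - 2 * (A * x ^ 2 + B * x + C) * ((A * x ^ 2 + B * x + C) * (y * z)))
        + D * (A * x ^ 2 + B * x + C) * ((A * x ^ 2 + B * x + C) * (y * z))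
        + E * (A * x ^ 2 + B * x + C) * ((A * x ^ 2 + B * x + C) * (y + z))
        + F * (A * x ^ 2 + B * x + C) ^ 2 := by
    unfold biquad; ring
  rw [this, hs', hm']
  unfold delta3 at hΔ
  linear_combination (biquad A B C D E F x x) * hΔ + (by unfold biquad; ring :
    A * (C * x ^ 2 + E * x + F) ^ 2
      + B * (C * x ^ 2 + E * x + F) * -(B * x ^ 2 + D * x + E)
      + C * ((-(B * x ^ 2 + D * x + E)) ^ 2
        - 2 * (A * x ^ 2 + B * x + C) * (C * x ^ 2 + E * x + F))
      + D * (A * x ^ 2 + B * x + C) * (C * x ^ 2 + E * x + F)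
      + E * (A * x ^ 2 + B * x + C) * -(B * x ^ 2 + D * x + E)
      + F * (A * x ^ 2 + B * x + C) ^ 2
    = biquad A B C D E F x x * (A * F + D * C - C ^ 2 - B * E))

/-- Nonvanishing of this polynomial makes the quadrilateral through `x` nondegenerate. -/
def generic4 {R : Type*} [CommRing R] (A B C D E F x : R) : R :=
  -- The opposite vertex will be n/d. The last factor is d²Φ(x, n/d), which keeps n/d away from the
  -- neighbours of x.
  let n := (C * B - A * E) * x - (B * E - C * D)
  let d := (A * D - B ^ 2) * x - (C * B - A * E)
  generic3 A B C D E F x * d * (n - x * d)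
    * (A * x ^ 2 * n ^ 2 + B * (x ^ 2 * n * d + x * n ^ 2) + C * (x ^ 2 * d ^ 2 + n ^ 2)
      + D * x * n * d + E * (x * d ^ 2 + n * d) + F * d ^ 2)

theorem exists_four_cycle {A B C D E F x : ℂ} (hΔ : delta4 A B C D E F = 0)
    (h : generic4 A B C D E F x ≠ 0) : ∃ y z w, x ≠ y ∧ x ≠ z ∧ x ≠ w ∧ y ≠ z ∧ y ≠ w ∧ z ≠ w ∧
      biquad A B C D E F x y = 0 ∧ biquad A B C D E F y z = 0 ∧ biquad A B C D E F z w = 0 ∧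
      biquad A B C D E F x w = 0 := by
  obtain ⟨⟨⟨⟨⟨hp, hx⟩, hd⟩, hden⟩, hxz⟩, hH⟩ := by
    simpa only [generic4, generic3, mul_ne_zero_iff] using h
  obtain ⟨y, w, hyw, hs, hm⟩ := exists_distinct_roots hp hd
  have h1 : biquad A B C D E F x y = 0 := by
    rw [biquad_left]; exact root_of_vieta hs hm
  have h2 : biquad A B C D E F x w = 0 := by
    rw [biquad_left]; exact root_of_vieta (add_comm y w ▸ hs) (mul_comm y w ▸ hm)
  -- When Δ₄ = 0, a column of the adjugate of M lies in its kernel. This z makes (z², z, 1) a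
  -- combination of (x², x, 1) and that column, so Φ(z, ·) is a multiple of Φ(x, ·) and z has the
  -- same neighbours as x.
  obtain ⟨z, hz⟩ : ∃ z, ((A * D - B ^ 2) * x - (C * B - A * E)) * z
      = (C * B - A * E) * x - (B * E - C * D) := ⟨_, mul_div_cancel₀ _ hden⟩
  have hzx : biquad A B C D E F x z ≠ 0 := by
    intro h0
    apply hH
    rw [← hz]
    unfold biquad at h0
    linear_combination ((A * D - B ^ 2) * x - (C * B - A * E)) ^ 2 * h0
  have key (t : ℂ) (ht : biquad A B C D E F x t = 0) : biquad A B C D E F z t = 0 := by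
    apply mul_left_cancel₀ (pow_ne_zero 2 hden)
    have e1 : ((A * D - B ^ 2) * x - (C * B - A * E)) ^ 2 * biquad A B C D E F z t
      = (A * t ^ 2 + B * t + C) * (((A * D - B ^ 2) * x - (C * B - A * E)) * z) ^ 2
        + (B * t ^ 2 + D * t + E) * (((A * D - B ^ 2) * x - (C * B - A * E)) * z)
          * ((A * D - B ^ 2) * x - (C * B - A * E))
        + (C * t ^ 2 + E * t + F) * ((A * D - B ^ 2) * x - (C * B - A * E)) ^ 2 := by
      unfold biquad; ring
    rw [e1, hz]
    unfold biquad at ht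
    unfold delta4 at hΔ
    linear_combination ((C * B - A * E) ^ 2 - (B * E - C * D) * (A * D - B ^ 2)) * ht
      + ((A * D - B ^ 2) * x ^ 2 - 2 * (C * B - A * E) * x + (B * E - C * D)) * hΔ
  refine ⟨y, z, w, by rintro rfl; exact hx h1, ?_, by rintro rfl; exact hx h2,
    by rintro rfl; exact hzx h1, hyw, by rintro rfl; exact hzx h2, h1, ?_, key w h2, h2⟩
  · rintro rfl
    apply hxz
    linear_combination -hz
  · rw [biquad_comm]
    exact key y h1

/-- Nonvanishing of this polynomial makes the pentagon through `0` nondegenerate. -/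
def generic5 {R : Type*} [CommRing R] (A B C D E F : R) : R :=
  -- The second neighbour of a root t of Φ(0, ·) is -(γt + δ)/(αt + β). The three factors of the
  -- form Cβ² - Eαβ + Fα² are resultants with Φ(0, ·); they exclude a zero denominator, a zero
  -- numerator and a second neighbour equal to t. The factor γβ - αδ separates the two second
  -- neighbours.
  let α := B * C - A * E
  let β := C ^ 2 - A * F
  let γ := C * D - B * E
  let δ := C * E - B * F
  let α' := C * (β + γ) - α * E
  let β' := C * δ - α * F
  C * F * (E ^ 2 - 4 * C * F) * delta3 A B C D E F * (C * β ^ 2 - E * α * β + F * α ^ 2)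
    * (C * δ ^ 2 - E * γ * δ + F * γ ^ 2) * (γ * β - α * δ)
    * (C * β' ^ 2 - E * α' * β' + F * α' ^ 2)

theorem exists_five_cycle {A B C D E F : ℂ} (hΔ : delta5 A B C D E F = 0)
    (h : generic5 A B C D E F ≠ 0) : ∃ x y u v z,
      x ≠ y ∧ x ≠ u ∧ x ≠ v ∧ x ≠ z ∧ y ≠ u ∧ y ≠ v ∧ y ≠ z ∧ u ≠ v ∧ u ≠ z ∧ v ≠ z ∧
      biquad A B C D E F x y = 0 ∧ biquad A B C D E F y u = 0 ∧ biquad A B C D E F u v = 0 ∧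
      biquad A B C D E F v z = 0 ∧ biquad A B C D E F x z = 0 := by
  obtain ⟨⟨⟨⟨⟨⟨⟨hC, hF⟩, hd⟩, h3⟩, hP⟩, hQ⟩, hS⟩, hT⟩ := by
    simpa only [generic5, mul_ne_zero_iff] using h
  obtain ⟨y, z, hyz, hs, hm⟩ := exists_distinct_roots hC hd
  have hy := root_of_vieta hs hm
  have hz := root_of_vieta (add_comm y z ▸ hs) (mul_comm y z ▸ hm)
  have hne {t : ℂ} (ht : C * t ^ 2 + E * t + F = 0) : 0 ≠ t := by
    rintro rfl
    apply hF
    linear_combination ht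
  have hyz0 : biquad A B C D E F y z ≠ 0 := by
    intro h0
    have := biquad_neighbors_of_zero (A := A) (B := B) (D := D) hs hm
    rw [h0, mul_zero] at this
    exact mul_ne_zero h3 hF this.symm
  have second {t : ℂ} (ht : C * t ^ 2 + E * t + F = 0) :
      ∃ u, 0 ≠ u ∧ t ≠ u ∧ biquad A B C D E F t u = 0 ∧
        ((B * C - A * E) * t + (C ^ 2 - A * F)) ≠ 0 ∧
        ((B * C - A * E) * t + (C ^ 2 - A * F)) * u
          + ((C * D - B * E) * t + (C * E - B * F)) = 0 := by
    have hw : (B * C - A * E) * t + (C ^ 2 - A * F) ≠ 0 :=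
      fun h0 => hP (quadratic_root_resultant h0 ht)
    have hv : (C * D - B * E) * t + (C * E - B * F) ≠ 0 :=
      fun h0 => hQ (quadratic_root_resultant h0 ht)
    obtain ⟨u, hu⟩ : ∃ u, ((B * C - A * E) * t + (C ^ 2 - A * F)) * u
        = -((C * D - B * E) * t + (C * E - B * F)) := ⟨_, mul_div_cancel₀ _ hw⟩
    refine ⟨u, ?_, ?_, ?_, hw, by linear_combination hu⟩
    · rintro rfl
      apply hv
      linear_combination hu
    · rintro rfl
      refine hT (quadratic_root_resultant (y := t) ?_ ht)
      linear_combination C * hu - (B * C - A * E) * ht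
    · apply mul_left_cancel₀ hC
      unfold biquad
      linear_combination u * hu + (A * u ^ 2 + B * u + C) * ht
  obtain ⟨u, hu0, hyu, h2, hwy, hu⟩ := second hy
  obtain ⟨v, hv0, hzv, h4, hwz, hv⟩ := second hz
  have hR : resP A B C E F ≠ 0 := by
    intro h0
    apply hP
    unfold resP at h0
    linear_combination C * h0
  refine ⟨0, y, u, v, z, hne hy, hu0, hv0, hne hz, hyu, ?_, hyz, ?_, ?_, hzv.symm, ?_, h2, ?_, ?_,
    ?_⟩
  · rintro rfl
    exact hyz0 (biquad_comm A B C D E F z y ▸ h4)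
  · rintro rfl
    have h0 : ((C * D - B * E) * (C ^ 2 - A * F) - (B * C - A * E) * (C * E - B * F))
        * (y - z) = 0 := by
      linear_combination ((B * C - A * E) * z + (C ^ 2 - A * F)) * hu
        - ((B * C - A * E) * y + (C ^ 2 - A * F)) * hv
    exact mul_ne_zero hS (sub_ne_zero.mpr hyz) h0
  · rintro rfl
    exact hyz0 h2
  · rw [biquad_left]
    linear_combination hy
  · have := biquad_second_neighbors hC hs hm hu hv
    rw [hΔ, zero_mul, zero_mul, mul_eq_zero] at this
    exact this.resolve_left (pow_ne_zero 2 hR)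
  · rw [biquad_comm]
    exact h4
  · rw [biquad_left]
    linear_combination hz

/-! ### Compatibility of the invariants with ring homomorphisms -/

section Map

variable {R S G : Type*} [CommRing R] [CommRing S] [FunLike G R S] [RingHomClass G R S]

theorem map_delta3 (f : G) (A B C D E F : R) :
    f (delta3 A B C D E F) = delta3 (f A) (f B) (f C) (f D) (f E) (f F) := by
  simp only [delta3, map_add, map_sub, map_mul, map_pow]

theorem map_delta4 (f : G) (A B C D E F : R) :
    f (delta4 A B C D E F) = delta4 (f A) (f B) (f C) (f D) (f E) (f F) := by
  simp only [delta4, map_add, map_sub, map_mul, map_pow, map_ofNat]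

theorem map_delta5 (f : G) (A B C D E F : R) :
    f (delta5 A B C D E F) = delta5 (f A) (f B) (f C) (f D) (f E) (f F) := by
  simp only [delta5, map_add, map_sub, map_mul, map_pow, map_ofNat]

theorem map_biquad (f : G) (A B C D E F x y : R) :
    f (biquad A B C D E F x y) = biquad (f A) (f B) (f C) (f D) (f E) (f F) (f x) (f y) := by
  simp only [biquad, map_add, map_mul, map_pow]

theorem map_generic3 (f : G) (A B C D E F x : R) :
    f (generic3 A B C D E F x) = generic3 (f A) (f B) (f C) (f D) (f E) (f F) (f x) := by
  simp only [generic3, map_biquad, map_add, map_sub, map_mul, map_pow, map_ofNat]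

theorem map_generic4 (f : G) (A B C D E F x : R) :
    f (generic4 A B C D E F x) = generic4 (f A) (f B) (f C) (f D) (f E) (f F) (f x) := by
  simp only [generic4, map_generic3, map_add, map_sub, map_mul, map_pow]

theorem map_generic5 (f : G) (A B C D E F : R) :
    f (generic5 A B C D E F) = generic5 (f A) (f B) (f C) (f D) (f E) (f F) := by
  simp only [generic5, map_delta3, map_add, map_sub, map_mul, map_pow, map_ofNat]

end Map

/-! ### Irreducibility of the three invariants -/

section Irreducibility

theorem isRelPrime_of_aeval {σ : Type*} {f g : MvPolynomial σ ℂ} (hf : Irreducible f) (P : σ → ℂ)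
    (hfP : MvPolynomial.aeval P f = 0) (hgP : MvPolynomial.aeval P g ≠ 0) : IsRelPrime f g := by
  rw [hf.isRelPrime_iff_not_dvd]
  rintro ⟨k, rfl⟩
  rw [map_mul, hfP, zero_mul] at hgP
  exact hgP rfl

theorem notMem_vars_of_mem_supported {σ : Type*} {f : MvPolynomial σ ℂ} {i : σ}
    (h : f ∈ MvPolynomial.supported ℂ ({i}ᶜ : Set σ)) : i ∉ f.vars := fun hi =>
  MvPolynomial.mem_supported.mp h hi rfl

/-- The point of coefficient space with the given coordinates. -/
def coefPoint (A B C D E F : ℂ) (s : Coef 2) : ℂ :=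
  if s = s(2, 2) then A else if s = s(2, 1) then B else if s = s(2, 0) then C
  else if s = s(1, 1) then D else if s = s(1, 0) then E else F

section

variable (A B C D E F : ℂ)

@[simp] theorem coefPoint_22 : coefPoint A B C D E F s(2, 2) = A := if_pos rfl
@[simp] theorem coefPoint_21 : coefPoint A B C D E F s(2, 1) = B := by
  rw [coefPoint, if_neg (by decide), if_pos rfl]
@[simp] theorem coefPoint_20 : coefPoint A B C D E F s(2, 0) = C := by
  rw [coefPoint, if_neg (by decide), if_neg (by decide), if_pos rfl]
@[simp] theorem coefPoint_11 : coefPoint A B C D E F s(1, 1) = D := by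
  rw [coefPoint, if_neg (by decide), if_neg (by decide), if_neg (by decide), if_pos rfl]
@[simp] theorem coefPoint_10 : coefPoint A B C D E F s(1, 0) = E := by
  rw [coefPoint, if_neg (by decide), if_neg (by decide), if_neg (by decide), if_neg (by decide),
    if_pos rfl]
@[simp] theorem coefPoint_00 : coefPoint A B C D E F s(0, 0) = F := by
  rw [coefPoint, if_neg (by decide), if_neg (by decide), if_neg (by decide), if_neg (by decide),
    if_neg (by decide)]

end

/-- The coefficient variables of `ℂ[a, x₁]`. -/
noncomputable abbrev coefX (s : Coef 2) : RingAX 2 := MvPolynomial.X (Sum.inl s)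

theorem coefX_mem_supported {s t : Coef 2} (h : s ≠ t) :
    coefX s ∈ MvPolynomial.supported ℂ ({Sum.inl t}ᶜ : Set (Coef 2 ⊕ Unit)) := by
  simpa [coefX, MvPolynomial.X_mem_supported] using h

theorem Delta3_eq : Delta3 = delta3 (a 2 2) (a 2 1) (a 2 0) (a 1 1) (a 1 0) (a 0 0) := by
  unfold Delta3 delta3; ring

theorem Delta4_eq : Delta4 = delta4 (a 2 2) (a 2 1) (a 2 0) (a 1 1) (a 1 0) (a 0 0) := by
  unfold Delta4 delta4; ring

theorem Delta5_eq : Delta5 = delta5 (a 2 2) (a 2 1) (a 2 0) (a 1 1) (a 1 0) (a 0 0) := by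
  unfold Delta5 delta5; ring

theorem inclA_Delta3 : inclA 2 Delta3 = delta3 (coefX s(2, 2)) (coefX s(2, 1)) (coefX s(2, 0))
    (coefX s(1, 1)) (coefX s(1, 0)) (coefX s(0, 0)) := by
  simp [Delta3_eq, map_delta3, inclA, a]

theorem inclA_Delta4 : inclA 2 Delta4 = delta4 (coefX s(2, 2)) (coefX s(2, 1)) (coefX s(2, 0))
    (coefX s(1, 1)) (coefX s(1, 0)) (coefX s(0, 0)) := by
  simp [Delta4_eq, map_delta4, inclA, a]

theorem irreducible_inclA_Delta3 : Irreducible (inclA 2 Delta3) := by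
  have h22 : coefX s(2, 2) ∈ MvPolynomial.supported ℂ ({Sum.inl s(0, 0)}ᶜ : Set (Coef 2 ⊕ Unit)) :=
    coefX_mem_supported (by decide)
  have h21 : coefX s(2, 1) ∈ MvPolynomial.supported ℂ ({Sum.inl s(0, 0)}ᶜ : Set (Coef 2 ⊕ Unit)) :=
    coefX_mem_supported (by decide)
  have h20 : coefX s(2, 0) ∈ MvPolynomial.supported ℂ ({Sum.inl s(0, 0)}ᶜ : Set (Coef 2 ⊕ Unit)) :=
    coefX_mem_supported (by decide)
  have h11 : coefX s(1, 1) ∈ MvPolynomial.supported ℂ ({Sum.inl s(0, 0)}ᶜ : Set (Coef 2 ⊕ Unit)) :=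
    coefX_mem_supported (by decide)
  have h10 : coefX s(1, 0) ∈ MvPolynomial.supported ℂ ({Sum.inl s(0, 0)}ᶜ : Set (Coef 2 ⊕ Unit)) :=
    coefX_mem_supported (by decide)
  -- Δ₃ is linear in a₀₀; a point with a₂₂ = 0 where the constant term is nonzero shows that the two
  -- coefficients are coprime.
  have key := MvPolynomial.irreducible_mul_X_add (coefX s(2, 2))
    (coefX s(1, 1) * coefX s(2, 0) - coefX s(2, 0) ^ 2 - coefX s(2, 1) * coefX s(1, 0))
    (Sum.inl s(0, 0)) (MvPolynomial.X_ne_zero _) (notMem_vars_of_mem_supported h22)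
    (notMem_vars_of_mem_supported
      (sub_mem (sub_mem (mul_mem h11 h20) (pow_mem h20 2)) (mul_mem h21 h10)))
    (isRelPrime_of_aeval MvPolynomial.X_prime.irreducible
      (Sum.elim (coefPoint 0 0 1 0 0 0) 0) (by simp) (by simp))
  convert key using 1
  rw [inclA_Delta3, delta3]
  ring

theorem irreducible_inclA_Delta4 : Irreducible (inclA 2 Delta4) := by
  have h22 : coefX s(2, 2) ∈ MvPolynomial.supported ℂ ({Sum.inl s(0, 0)}ᶜ : Set (Coef 2 ⊕ Unit)) :=
    coefX_mem_supported (by decide)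
  have h21 : coefX s(2, 1) ∈ MvPolynomial.supported ℂ ({Sum.inl s(0, 0)}ᶜ : Set (Coef 2 ⊕ Unit)) :=
    coefX_mem_supported (by decide)
  have h20 : coefX s(2, 0) ∈ MvPolynomial.supported ℂ ({Sum.inl s(0, 0)}ᶜ : Set (Coef 2 ⊕ Unit)) :=
    coefX_mem_supported (by decide)
  have h11 : coefX s(1, 1) ∈ MvPolynomial.supported ℂ ({Sum.inl s(0, 0)}ᶜ : Set (Coef 2 ⊕ Unit)) :=
    coefX_mem_supported (by decide)
  have h10 : coefX s(1, 0) ∈ MvPolynomial.supported ℂ ({Sum.inl s(0, 0)}ᶜ : Set (Coef 2 ⊕ Unit)) :=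
    coefX_mem_supported (by decide)
  have h2 : (2 : RingAX 2) ∈ MvPolynomial.supported ℂ ({Sum.inl s(0, 0)}ᶜ : Set (Coef 2 ⊕ Unit)) :=
    ofNat_mem _ 2
  -- Δ₄ is linear in a₀₀ with this minor as coefficient, and the minor is itself linear in a₂₂.
  have minor := MvPolynomial.irreducible_mul_X_add (coefX s(1, 1)) (-coefX s(2, 1) ^ 2)
    (Sum.inl s(2, 2)) (MvPolynomial.X_ne_zero _)
    (notMem_vars_of_mem_supported (coefX_mem_supported (by decide)))
    (notMem_vars_of_mem_supported
      (neg_mem (pow_mem (coefX_mem_supported (by decide)) 2)))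
    (isRelPrime_of_aeval MvPolynomial.X_prime.irreducible
      (Sum.elim (coefPoint 0 1 0 0 0 0) 0) (by simp) (by simp))
  have key := MvPolynomial.irreducible_mul_X_add _
    (2 * coefX s(2, 1) * coefX s(2, 0) * coefX s(1, 0) - coefX s(2, 2) * coefX s(1, 0) ^ 2
      - coefX s(1, 1) * coefX s(2, 0) ^ 2)
    (Sum.inl s(0, 0)) minor.ne_zero
    (notMem_vars_of_mem_supported (add_mem (mul_mem h11 h22) (neg_mem (pow_mem h21 2))))
    (notMem_vars_of_mem_supported
      (sub_mem (sub_mem (mul_mem (mul_mem (mul_mem h2 h21) h20) h10) (mul_mem h22 (pow_mem h10 2)))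
        (mul_mem h11 (pow_mem h20 2))))
    (isRelPrime_of_aeval minor
      (Sum.elim (coefPoint 1 1 1 1 0 0) 0) (by simp) (by simp))
  convert key using 1
  rw [inclA_Delta4, delta4]
  ring

open Polynomial in
-- If n has degree at least 2, the term n³ dominates. A linear n is excluded by its values at 0, 1
-- and -1.
theorem cubic_ne_zero (n : ℂ[X]) : n ^ 3 - X * n ^ 2 + X * (1 - X) * n + X ^ 3 ≠ 0 := by
  intro h
  have hn : n.natDegree ≤ 1 := by
    by_contra! hd
    have e : n ^ 3 = X * n ^ 2 - X * (1 - X) * n - X ^ 3 := by linear_combination h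
    have h3 : (n ^ 3).natDegree = 3 * n.natDegree := natDegree_pow n 3
    have b1 : (X * n ^ 2).natDegree ≤ 1 + 2 * n.natDegree :=
      natDegree_mul_le_of_le natDegree_X_le natDegree_pow_le
    have b2 : (X * (1 - X) * n).natDegree ≤ 2 + n.natDegree :=
      natDegree_mul_le_of_le (by compute_degree) le_rfl
    have b3 : (X ^ 3 : ℂ[X]).natDegree ≤ 3 := natDegree_X_pow_le 3
    have b4 := natDegree_sub_le (X * n ^ 2 - X * (1 - X) * n) (X ^ 3)
    have b5 := natDegree_sub_le (X * n ^ 2) (X * (1 - X) * n)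
    rw [← e] at b4
    omega
  obtain ⟨α, β, rfl⟩ := exists_eq_X_add_C_of_natDegree_le_one hn
  have h0 := congrArg (eval 0) h
  have h1 := congrArg (eval 1) h
  have h2 := congrArg (eval (-1)) h
  simp at h0 h1 h2
  subst h0
  obtain rfl : α = 0 := by linear_combination (h1 + h2) / 2
  simp at h1

theorem delta5_eq_sextic {R : Type*} [CommRing R] (A B C D E F : R) :
    -delta5 A B C D E F = C ^ 6 + (D * C ^ 5 + -(5 * B * E + D ^ 2 + 3 * A * F) * C ^ 4
      + (4 * A * E ^ 2 + 4 * B * D * E + 4 * B ^ 2 * F - 2 * A * D * F) * C ^ 3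
      + -(E ^ 2 * B ^ 2 + 3 * A * D * E ^ 2 + 3 * B ^ 2 * D * F - 2 * A * B * E * F
        - 3 * A ^ 2 * F ^ 2 - A * D ^ 2 * F) * C ^ 2
      + -(E ^ 2 * B ^ 2 * D - A * D ^ 2 * E ^ 2 + 4 * A ^ 2 * E ^ 2 * F - B ^ 2 * D ^ 2 * F
        - 4 * A * B * D * E * F + A * D ^ 3 * F + 4 * A * B ^ 2 * F ^ 2 - A ^ 2 * D * F ^ 2) * C
      + -delta5 A B 0 D E F) := by
  unfold delta5; ring

open Polynomial in
theorem monic_neg_delta5 {R : Type*} [CommRing R] (A B D E F : R) :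
    (-delta5 (C A) (C B) X (C D) (C E) (C F)).Monic := by
  have e : delta5 (C A) (C B) 0 (C D) (C E) (C F) = C (delta5 A B 0 D E F) := by
    rw [map_delta5, C_0]
  rw [delta5_eq_sextic, e]
  apply monic_X_pow_add
  have h2 : (2 : R[X]) = C 2 := rfl
  have h3 : (3 : R[X]) = C 3 := rfl
  have h4 : (4 : R[X]) = C 4 := rfl
  have h5 : (5 : R[X]) = C 5 := rfl
  rw [h2, h3, h4, h5]
  simp only [← C_mul, ← C_pow, ← C_add, ← C_neg, ← C_sub]
  refine lt_of_le_of_lt ?_ (by norm_num : (5 : WithBot ℕ) < 6)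
  compute_degree

open Polynomial in
-- With A = D = 1 and B = E = 0, Δ₅ is a monic cubic in F over ℂ[C], so it suffices that it has no
-- root; the shift by C² brings a root to the form of `cubic_ne_zero`.
theorem irreducible_cubic : Irreducible (delta5 1 0 (C X) 1 0 X : ℂ[X][X]) := by
  have e : (delta5 1 0 (C X) 1 0 X : ℂ[X][X])
      = X ^ 3 + (C (-3 * X ^ 2 - X) * X ^ 2 + C (3 * X ^ 4 + 2 * X ^ 3 - X ^ 2 + X) * X
        + C (X ^ 4 - X ^ 5 - X ^ 6)) := by
    simp only [delta5, map_add, map_sub, map_neg, map_mul, map_pow, map_ofNat]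
    ring
  have hm : (delta5 1 0 (C X) 1 0 X : ℂ[X][X]).Monic := by
    rw [e]
    apply monic_X_pow_add
    refine lt_of_le_of_lt ?_ (by norm_num : (2 : WithBot ℕ) < 3)
    compute_degree
  have hd : (delta5 1 0 (C X) 1 0 X : ℂ[X][X]).natDegree = 3 := by
    rw [e]
    compute_degree!
  rw [hm.irreducible_iff_roots_eq_zero_of_degree_le_three (by omega) (by omega),
    Multiset.eq_zero_iff_forall_notMem]
  intro m hr
  have hr := isRoot_of_mem_roots hr
  rw [e, IsRoot.def] at hr
  simp only [eval_add, eval_mul, eval_pow, eval_X, eval_C] at hr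
  apply cubic_ne_zero (m - X ^ 2)
  linear_combination hr

open Polynomial in
theorem irreducible_sextic : Irreducible (delta5 1 0 X 1 0 (C X) : ℂ[X][X]) := by
  rw [← MulEquiv.irreducible_iff (Bivariate.swap (R := ℂ))]
  convert irreducible_cubic using 1
  have h1 := Bivariate.swap_X (R := ℂ)
  have h2 := Bivariate.swap_Y (R := ℂ)
  rw [map_delta5, map_one, map_zero, h1, h2]

open Polynomial in
-- As a polynomial in a₂₀, -Δ₅ is monic of degree 6, so the factors of a factorisation have unit
-- leading coefficients and keep their degrees under specialisation of the other variables.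
-- Irreducibility of the specialised sextic therefore suffices.
theorem irreducible_Delta5 : Irreducible Delta5 := by
  -- `τ` makes a₂₀ the main variable, `ρ` is a left inverse, and `σ` specialises the coefficients.
  let τ : RingA 2 →ₐ[ℂ] (RingA 2)[X] :=
    MvPolynomial.aeval fun s => if s = s(2, 0) then X else C (MvPolynomial.X s)
  let ρ : (RingA 2)[X] →+* RingA 2 := evalRingHom (a 2 0)
  have hρ : ∀ g, ρ (τ g) = g := by
    intro g
    induction g using MvPolynomial.induction_on with
    | C c => simp [ρ, τ]
    | add p q hp hq => rw [map_add, map_add, hp, hq]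
    | mul_X p s hp =>
      rw [map_mul, map_mul, hp]
      by_cases hs : s = s(2, 0) <;> simp [ρ, τ, hs, a]
  let σ : RingA 2 →+* ℂ[X] :=
    (MvPolynomial.aeval fun s => if s = s(2, 2) ∨ s = s(1, 1) then 1
      else if s = s(0, 0) then X else 0 : RingA 2 →ₐ[ℂ] ℂ[X]).toRingHom
  have hτ20 : τ (a 2 0) = X := by simp [τ, a]
  have hτ (i j : Fin 3) (h : s(i, j) ≠ s(2, 0)) : τ (a i j) = C (a i j) := by
    simp [τ, a, -Sym2.eq, h]
  have hτΔ : τ Delta5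
      = delta5 (C (a 2 2)) (C (a 2 1)) X (C (a 1 1)) (C (a 1 0)) (C (a 0 0)) := by
    rw [Delta5_eq, ← hτ20, ← hτ 2 2 (by decide), ← hτ 2 1 (by decide), ← hτ 1 1 (by decide),
      ← hτ 1 0 (by decide), ← hτ 0 0 (by decide), map_delta5]
  have hσ (i j : Fin 3) : σ (a i j) = if s(i, j) = s(2, 2) ∨ s(i, j) = s(1, 1) then 1
      else if s(i, j) = s(0, 0) then X else 0 := by
    simp only [σ, a, AlgHom.toRingHom_eq_coe, RingHom.coe_coe, MvPolynomial.aeval_X]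
  have hσΔ : (τ Delta5).map σ = (delta5 1 0 X 1 0 (C X) : ℂ[X][X]) := by
    have h22 : σ (a 2 2) = 1 := by rw [hσ, if_pos (by decide)]
    have h21 : σ (a 2 1) = 0 := by rw [hσ, if_neg (by decide), if_neg (by decide)]
    have h11 : σ (a 1 1) = 1 := by rw [hσ, if_pos (by decide)]
    have h10 : σ (a 1 0) = 0 := by rw [hσ, if_neg (by decide), if_neg (by decide)]
    have h00 : σ (a 0 0) = X := by rw [hσ, if_neg (by decide), if_pos (by decide)]
    rw [hτΔ, ← coe_mapRingHom]
    simp only [map_delta5, coe_mapRingHom, map_C, map_X, h22, h21, h11, h10, h00, C_1, C_0]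
  have hmonic : (-τ Delta5).Monic := hτΔ ▸ monic_neg_delta5 _ _ _ _ _
  have unit_of_map {g k : RingA 2} (hgk : Delta5 = g * k) (hg : IsUnit ((τ g).map σ)) :
      IsUnit g := by
    have hl : IsUnit (τ g).leadingCoeff := by
      apply isUnit_of_dvd_one
      refine ⟨-(τ k).leadingCoeff, ?_⟩
      rw [mul_neg, ← leadingCoeff_mul, ← map_mul, ← hgk, ← leadingCoeff_neg]
      exact hmonic.leadingCoeff.symm
    have hd : (τ g).natDegree = 0 := by
      rw [← natDegree_map_eq_of_isUnit_leadingCoeff σ hl]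
      exact natDegree_eq_zero_of_isUnit hg
    rw [← hρ g, eq_C_of_natDegree_eq_zero hd]
    rw [leadingCoeff, hd] at hl
    exact (hl.map C).map ρ
  refine ⟨fun hu => irreducible_sextic.not_isUnit ?_, fun g k hgk => ?_⟩
  · rw [← hσΔ]
    exact (hu.map τ).map (mapRingHom σ)
  · have := irreducible_sextic.isUnit_or_isUnit
      (hσΔ.symm.trans (by rw [hgk, map_mul, Polynomial.map_mul]))
    exact this.imp (unit_of_map hgk) (unit_of_map (hgk.trans (mul_comm g k)))

end Irreducibility
-- Nullstellensatz and reduction of the ideals to points of W \ Z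
/-- An irreducible polynomial divides every polynomial vanishing at the generic points of its
zero set. -/
theorem dvd_of_vanishes_generically {σ : Type*} [Finite σ] {Δ h f : MvPolynomial σ ℂ}
    (hΔ : Irreducible Δ) (P₀ : σ → ℂ) (hP₀ : MvPolynomial.aeval P₀ Δ = 0)
    (hh : MvPolynomial.aeval P₀ h ≠ 0)
    (hf : ∀ P : σ → ℂ, MvPolynomial.aeval P Δ = 0 → MvPolynomial.aeval P h ≠ 0 →
      MvPolynomial.aeval P f = 0) : Δ ∣ f := by
  -- The product hf vanishes on all of V(Δ), hence lies in the prime ideal (Δ); the point P₀ shows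
  -- that Δ does not divide h.
  have hmem : h * f ∈ MvPolynomial.vanishingIdeal ℂ
      (MvPolynomial.zeroLocus ℂ (Ideal.span {Δ})) := by
    rw [MvPolynomial.zeroLocus_span, MvPolynomial.mem_vanishingIdeal_iff]
    intro P hP
    rw [map_mul, mul_eq_zero, or_iff_not_imp_left]
    exact hf P (hP Δ rfl)
  rw [MvPolynomial.vanishingIdeal_zeroLocus_eq_radical] at hmem
  have hprime := (Ideal.span_singleton_prime hΔ.ne_zero).mpr hΔ.prime
  rw [hprime.radical, Ideal.mem_span_singleton] at hmem
  refine (hΔ.prime.dvd_or_dvd hmem).resolve_left ?_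
  rintro ⟨k, rfl⟩
  rw [map_mul, hP₀, zero_mul] at hh
  exact hh rfl

section

variable {n : ℕ} (H : SimpleGraph (Fin n))

/-- The value of `Φ_a(x_i, x_j)` at a point. -/
theorem aeval_Phi (P : Pt 2 n) (i j : Fin n) :
    MvPolynomial.aeval P (Phi 2 i j) =
      biquad (P (Sum.inl s(2, 2))) (P (Sum.inl s(2, 1))) (P (Sum.inl s(2, 0)))
        (P (Sum.inl s(1, 1))) (P (Sum.inl s(1, 0))) (P (Sum.inl s(0, 0)))
        (P (Sum.inr i)) (P (Sum.inr j)) := by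
  have h01 : (s(0, 1) : Coef 2) = s(1, 0) := Sym2.eq_swap
  have h02 : (s(0, 2) : Coef 2) = s(2, 0) := Sym2.eq_swap
  have h12 : (s(1, 2) : Coef 2) = s(2, 1) := Sym2.eq_swap
  have hPhi : (Phi 2 i j : RingFull 2 n) = ∑ k : Fin 3, ∑ l : Fin 3,
      MvPolynomial.X (Sum.inl s(k, l)) * MvPolynomial.X (Sum.inr i) ^ (k : ℕ)
        * MvPolynomial.X (Sum.inr j) ^ (l : ℕ) := rfl
  simp only [hPhi, Fin.sum_univ_three, map_add, map_mul, map_pow, MvPolynomial.aeval_X, h01, h02,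
    h12, biquad, Fin.val_zero, Fin.val_one, Fin.val_two]
  ring

theorem mem_diff_iff (P : Pt 2 n) :
    P ∈ varietyW 2 H \ varietyZ 2 H ↔
      (∀ i j, H.Adj i j → biquad (P (Sum.inl s(2, 2))) (P (Sum.inl s(2, 1)))
        (P (Sum.inl s(2, 0))) (P (Sum.inl s(1, 1))) (P (Sum.inl s(1, 0))) (P (Sum.inl s(0, 0)))
        (P (Sum.inr i)) (P (Sum.inr j)) = 0) ∧ Function.Injective (P ∘ Sum.inr) := by
  have hW : P ∈ varietyW 2 H ↔ ∀ i j, H.Adj i j → MvPolynomial.aeval P (Phi 2 i j) = 0 := by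
    constructor
    · exact fun h i j hij => h _ ⟨i, j, hij, rfl⟩
    · rintro h _ ⟨i, j, hij, rfl⟩
      exact h i j hij
  simp only [aeval_Phi] at hW
  rw [Set.mem_sdiff, varietyZ, Set.mem_inter_iff, not_and, hW]
  refine and_congr_right fun h => ?_
  rw [imp_iff_right h]
  constructor
  · intro hP i j hij
    by_contra hne
    rcases lt_or_gt_of_ne hne with hlt | hlt
    · exact hP ⟨j, i, hlt, hij.symm⟩
    · exact hP ⟨i, j, hlt, hij⟩
  · rintro hP ⟨i, j, hlt, hij⟩
    exact hlt.ne' (hP hij)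

/-- A set and its Zariski closure have the same vanishing ideal. -/
theorem idealI_eq : idealI 2 H = MvPolynomial.vanishingIdeal ℂ (varietyW 2 H \ varietyZ 2 H) :=
  MvPolynomial.zeroLocus_vanishingIdeal_galoisConnection.u_l_u_eq_u _

theorem mem_charIdeal_iff (f : RingA 2) : f ∈ charIdeal 2 H ↔
    ∀ P ∈ varietyW 2 H \ varietyZ 2 H, MvPolynomial.aeval (P ∘ Sum.inl) f = 0 := by
  simp only [charIdeal, Ideal.mem_comap, idealI_eq, MvPolynomial.mem_vanishingIdeal_iff,
    MvPolynomial.aeval_rename]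

theorem mem_charIdealAt_iff (v : Fin n) (f : RingAX 2) : f ∈ charIdealAt 2 H v ↔
    ∀ P ∈ varietyW 2 H \ varietyZ 2 H,
      MvPolynomial.aeval (P ∘ Sum.map id fun _ : Unit => v) f = 0 := by
  simp only [charIdealAt, Ideal.mem_comap, idealI_eq, MvPolynomial.mem_vanishingIdeal_iff,
    MvPolynomial.aeval_rename]

theorem aeval_inclA (Q : Coef 2 ⊕ Unit → ℂ) (f : RingA 2) :
    MvPolynomial.aeval Q (inclA 2 f) = MvPolynomial.aeval (Q ∘ Sum.inl) f :=
  MvPolynomial.aeval_rename _ _ _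

theorem charIdealAt_eq_span (v : Fin n) {Δ : RingA 2} {h : RingAX 2}
    (hΔ : Irreducible (inclA 2 Δ)) (Q₀ : Coef 2 ⊕ Unit → ℂ)
    (hQ₀ : MvPolynomial.aeval (Q₀ ∘ Sum.inl) Δ = 0) (hh : MvPolynomial.aeval Q₀ h ≠ 0)
    (hvanish : Δ ∈ charIdeal 2 H)
    (hexists : ∀ Q : Coef 2 ⊕ Unit → ℂ, MvPolynomial.aeval (Q ∘ Sum.inl) Δ = 0 →
      MvPolynomial.aeval Q h ≠ 0 →
      ∃ P ∈ varietyW 2 H \ varietyZ 2 H, P ∘ Sum.map id (fun _ : Unit => v) = Q) :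
    charIdealAt 2 H v = Ideal.span {inclA 2 Δ} := by
  apply le_antisymm
  · intro f hf
    rw [Ideal.mem_span_singleton]
    refine dvd_of_vanishes_generically hΔ Q₀ ((aeval_inclA _ _).trans hQ₀) hh fun Q hQ hhQ => ?_
    obtain ⟨P, hP, rfl⟩ := hexists Q ((aeval_inclA _ _).symm.trans hQ) hhQ
    exact (mem_charIdealAt_iff H v f).mp hf P hP
  · rw [Ideal.span_singleton_le_iff_mem, mem_charIdealAt_iff]
    intro P hP
    rw [aeval_inclA]
    exact (mem_charIdeal_iff H Δ).mp hvanish P hP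

theorem charIdeal_eq_span (v : Fin n) {Δ : RingA 2} (hvanish : Δ ∈ charIdeal 2 H)
    (hat : charIdealAt 2 H v = Ideal.span {inclA 2 Δ}) : charIdeal 2 H = Ideal.span {Δ} := by
  apply le_antisymm
  · intro f hf
    have hmem : inclA 2 f ∈ charIdealAt 2 H v := by
      rw [mem_charIdealAt_iff]
      intro P hP
      rw [aeval_inclA]
      exact (mem_charIdeal_iff H f).mp hf P hP
    rw [hat, Ideal.mem_span_singleton] at hmem
    -- Setting x₁ = 0 is a retraction onto ℂ[a], so divisibility descends.
    let ρ : RingAX 2 →ₐ[ℂ] RingA 2 := MvPolynomial.aeval (Sum.elim MvPolynomial.X 0)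
    have hρ (g : RingA 2) : ρ (inclA 2 g) = g := by
      simp only [ρ, inclA, MvPolynomial.aeval_rename, Sum.elim_comp_inl,
        MvPolynomial.aeval_X_left, AlgHom.id_apply]
    rw [Ideal.mem_span_singleton, ← hρ f, ← hρ Δ]
    exact map_dvd ρ hmem
  · rwa [Ideal.span_singleton_le_iff_mem]

end

theorem aeval_Delta3 (P : Coef 2 → ℂ) : MvPolynomial.aeval P Delta3 = delta3 (P s(2, 2))
    (P s(2, 1)) (P s(2, 0)) (P s(1, 1)) (P s(1, 0)) (P s(0, 0)) := by
  simp only [Delta3_eq, map_delta3, a, MvPolynomial.aeval_X]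

theorem aeval_Delta4 (P : Coef 2 → ℂ) : MvPolynomial.aeval P Delta4 = delta4 (P s(2, 2))
    (P s(2, 1)) (P s(2, 0)) (P s(1, 1)) (P s(1, 0)) (P s(0, 0)) := by
  simp only [Delta4_eq, map_delta4, a, MvPolynomial.aeval_X]

theorem aeval_Delta5 (P : Coef 2 → ℂ) : MvPolynomial.aeval P Delta5 = delta5 (P s(2, 2))
    (P s(2, 1)) (P s(2, 0)) (P s(1, 1)) (P s(1, 0)) (P s(0, 0)) := by
  simp only [Delta5_eq, map_delta5, a, MvPolynomial.aeval_X]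

/-! ### The ideals of the cycles of length 3, 4 and 5 -/

theorem Delta3_mem : Delta3 ∈ charIdeal 2 (SimpleGraph.cycleGraph 3) := by
  rw [mem_charIdeal_iff]
  intro P hP
  obtain ⟨hW, hinj⟩ := (mem_diff_iff _ P).mp hP
  rw [aeval_Delta3]
  exact delta3_eq_zero_of_triangle (hinj.ne (by decide : (0 : Fin 3) ≠ 1))
    (hinj.ne (by decide : (1 : Fin 3) ≠ 2)) (hinj.ne (by decide : (0 : Fin 3) ≠ 2))
    (hW 0 1 (by decide)) (hW 1 2 (by decide)) (hW 0 2 (by decide))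

theorem Delta4_mem : Delta4 ∈ charIdeal 2 (SimpleGraph.cycleGraph 4) := by
  rw [mem_charIdeal_iff]
  intro P hP
  obtain ⟨hW, hinj⟩ := (mem_diff_iff _ P).mp hP
  rw [aeval_Delta4]
  exact delta4_eq_zero_of_cycle (hinj.ne (by decide : (0 : Fin 4) ≠ 2))
    (hinj.ne (by decide : (1 : Fin 4) ≠ 3))
    (hW 0 1 (by decide)) (hW 1 2 (by decide)) (hW 2 3 (by decide)) (hW 0 3 (by decide))

theorem Delta5_mem : Delta5 ∈ charIdeal 2 (SimpleGraph.cycleGraph 5) := by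
  rw [mem_charIdeal_iff]
  intro P hP
  obtain ⟨hW, hinj⟩ := (mem_diff_iff _ P).mp hP
  rw [aeval_Delta5]
  exact delta5_eq_zero_of_cycle (hinj.ne (by decide : (1 : Fin 5) ≠ 4))
    (hinj.ne (by decide : (1 : Fin 5) ≠ 0)) (hinj.ne (by decide : (4 : Fin 5) ≠ 0))
    (hinj.ne (by decide : (2 : Fin 5) ≠ 0)) (hinj.ne (by decide : (3 : Fin 5) ≠ 0))
    (hinj.ne (by decide : (4 : Fin 5) ≠ 2))
    (hW 0 1 (by decide)) (hW 1 2 (by decide)) (hW 2 3 (by decide)) (hW 3 4 (by decide))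
    (hW 0 4 (by decide))

theorem charIdealAt_three :
    charIdealAt 2 (SimpleGraph.cycleGraph 3) 0 = Ideal.span {inclA 2 Delta3} := by
  refine charIdealAt_eq_span _ 0 (h := generic3 (coefX s(2, 2)) (coefX s(2, 1)) (coefX s(2, 0))
    (coefX s(1, 1)) (coefX s(1, 0)) (coefX s(0, 0)) (MvPolynomial.X (Sum.inr ())))
    -- The sample point, Φ = x²y² + x² + y² + 1 with x₁ = 0, only has to satisfy Δ₃ = 0 and lie in
    -- the generic locus.
    irreducible_inclA_Delta3 (Sum.elim (coefPoint 1 0 1 0 0 1) 0) ?_ ?_ Delta3_mem ?_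
  · rw [Sum.elim_comp_inl, aeval_Delta3]
    norm_num [delta3]
  · rw [map_generic3]
    norm_num [generic3, biquad]
  · intro Q hQ hh
    rw [aeval_Delta3] at hQ
    simp only [map_generic3, MvPolynomial.aeval_X] at hh
    obtain ⟨y, z, hxy, hxz, hyz, h1, h2, h3⟩ := exists_triangle hQ hh
    refine ⟨Sum.elim (Q ∘ Sum.inl) ![Q (Sum.inr ()), y, z], (mem_diff_iff _ _).mpr ⟨?_, ?_⟩, ?_⟩
    · intro i j hij
      wlog hlt : i < j generalizing i j
      · rw [biquad_comm]
        exact this j i hij.symm (lt_of_le_of_ne (not_lt.mp hlt) hij.ne')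
      fin_cases i <;> fin_cases j <;> first | exact absurd hlt (by decide) | assumption
    · rw [Sum.elim_comp_inr]
      intro i j hij
      by_contra hne
      wlog hlt : i < j generalizing i j
      · exact this hij.symm (Ne.symm hne) (lt_of_le_of_ne (not_lt.mp hlt) (Ne.symm hne))
      fin_cases i <;> fin_cases j <;> first | exact absurd hlt (by decide) | contradiction
    · ext (s | _) <;> rfl

theorem charIdealAt_four :
    charIdealAt 2 (SimpleGraph.cycleGraph 4) 0 = Ideal.span {inclA 2 Delta4} := by
  refine charIdealAt_eq_span _ 0 (h := generic4 (coefX s(2, 2)) (coefX s(2, 1)) (coefX s(2, 0))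
    (coefX s(1, 1)) (coefX s(1, 0)) (coefX s(0, 0)) (MvPolynomial.X (Sum.inr ())))
    irreducible_inclA_Delta4 (Sum.elim (coefPoint 0 1 1 0 0 0) 1) ?_ ?_ Delta4_mem ?_
  · rw [Sum.elim_comp_inl, aeval_Delta4]
    norm_num [delta4]
  · rw [map_generic4]
    norm_num [generic4, generic3, biquad]
  · intro Q hQ hh
    rw [aeval_Delta4] at hQ
    simp only [map_generic4, MvPolynomial.aeval_X] at hh
    obtain ⟨y, z, w, hxy, hxz, hxw, hyz, hyw, hzw, h1, h2, h3, h4⟩ := exists_four_cycle hQ hh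
    refine ⟨Sum.elim (Q ∘ Sum.inl) ![Q (Sum.inr ()), y, z, w],
      (mem_diff_iff _ _).mpr ⟨?_, ?_⟩, ?_⟩
    · intro i j hij
      wlog hlt : i < j generalizing i j
      · rw [biquad_comm]
        exact this j i hij.symm (lt_of_le_of_ne (not_lt.mp hlt) hij.ne')
      fin_cases i <;> fin_cases j <;>
        first | exact absurd hlt (by decide) | exact absurd hij (by decide) | assumption
    · rw [Sum.elim_comp_inr]
      intro i j hij
      by_contra hne
      wlog hlt : i < j generalizing i j
      · exact this hij.symm (Ne.symm hne) (lt_of_le_of_ne (not_lt.mp hlt) (Ne.symm hne))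
      fin_cases i <;> fin_cases j <;> first | exact absurd hlt (by decide) | contradiction
    · ext (s | _) <;> rfl

theorem charIdeal_five :
    charIdeal 2 (SimpleGraph.cycleGraph 5) = Ideal.span {Delta5} := by
  apply le_antisymm
  · intro f hf
    rw [Ideal.mem_span_singleton]
    -- A sample point of Δ₅ = 0 at which `generic5` does not vanish.
    refine dvd_of_vanishes_generically irreducible_Delta5 (coefPoint (-1) 0 1 (-1) (-1) 2)
      (h := generic5 (a 2 2) (a 2 1) (a 2 0) (a 1 1) (a 1 0) (a 0 0)) ?_ ?_ ?_
    · rw [aeval_Delta5]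
      norm_num [delta5]
    · rw [map_generic5]
      norm_num [generic5, delta3, a]
    intro Q hQ hh
    rw [aeval_Delta5] at hQ
    simp only [map_generic5, a, MvPolynomial.aeval_X] at hh
    obtain ⟨x, y, u, v, z, hxy, hxu, hxv, hxz, hyu, hyv, hyz, huv, huz, hvz, h1, h2, h3, h4, h5⟩ :=
      exists_five_cycle hQ hh
    refine (mem_charIdeal_iff _ f).mp hf (Sum.elim Q ![x, y, u, v, z])
      ((mem_diff_iff _ _).mpr ⟨?_, ?_⟩)
    · intro i j hij
      wlog hlt : i < j generalizing i j
      · rw [biquad_comm]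
        exact this j i hij.symm (lt_of_le_of_ne (not_lt.mp hlt) hij.ne')
      fin_cases i <;> fin_cases j <;>
        first | exact absurd hlt (by decide) | exact absurd hij (by decide) | assumption
    · rw [Sum.elim_comp_inr]
      intro i j hij
      by_contra hne
      wlog hlt : i < j generalizing i j
      · exact this hij.symm (Ne.symm hne) (lt_of_le_of_ne (not_lt.mp hlt) (Ne.symm hne))
      fin_cases i <;> fin_cases j <;> first | exact absurd hlt (by decide) | contradiction
  · rw [Ideal.span_singleton_le_iff_mem]
    exact Delta5_mem

end PolyGraph

theorem mainTheorem8 :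
    PolyGraph.charIdeal 2 (SimpleGraph.cycleGraph 3) = Ideal.span {PolyGraph.Delta3} ∧
    PolyGraph.charIdeal 2 (SimpleGraph.cycleGraph 4) = Ideal.span {PolyGraph.Delta4} ∧
    PolyGraph.charIdeal 2 (SimpleGraph.cycleGraph 5) = Ideal.span {PolyGraph.Delta5} ∧
    PolyGraph.charIdealAt 2 (SimpleGraph.cycleGraph 3) 0 =
      (PolyGraph.charIdeal 2 (SimpleGraph.cycleGraph 3)).map (PolyGraph.inclA 2) ∧
    PolyGraph.charIdealAt 2 (SimpleGraph.cycleGraph 4) 0 =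
      (PolyGraph.charIdeal 2 (SimpleGraph.cycleGraph 4)).map (PolyGraph.inclA 2) := by
  have h3 := PolyGraph.charIdeal_eq_span _ 0 PolyGraph.Delta3_mem PolyGraph.charIdealAt_three
  have h4 := PolyGraph.charIdeal_eq_span _ 0 PolyGraph.Delta4_mem PolyGraph.charIdealAt_four
  refine ⟨h3, h4, PolyGraph.charIdeal_five, ?_, ?_⟩
  · rw [h3, Ideal.map_span, Set.image_singleton, PolyGraph.charIdealAt_three]
  · rw [h4, Ideal.map_span, Set.image_singleton, PolyGraph.charIdealAt_four]
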